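/- Let $X$ be a real Banach lattice with order continuous norm, i.e. every downward directed subset of $X$ with infimum $0$, viewed as a decreasing net, converges to $0$ in norm. Then the following two conditions are equivalent: 1. $X$ is weakly compactly generated as a band (BWCG): there is a weakly compact set $K\subset X$ such that $X=B(K)$, where $B(K)$ denotes the smallest closed band of $X$ containing $K$. 2. $X$ is weakly compactly generated (WCG): there is a weakly compact set $K\subset X$ whose closed linear span is $X$. Here an ideal of $X$ is a linear subspace $Y$ such that $|x|\le|y|$ and $y\in Y$ imply $x\in Y$, and a band is an ideal $Z$ such that $\sup A\in Z$ whenever $A\subset Z$ and $\sup A$ exists in $X$. -/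

import Mathlib

open Filter Topology

/-- A set in a real Banach space is weakly compact if it is compact in the weak topology. -/
def IsWeaklyCompact {X : Type*} [NormedAddCommGroup X] [NormedSpace ℝ X] (K : Set X) : Prop :=
  IsCompact (toWeakSpace ℝ X '' K)

/-- Weakly compactly generated: the closed linear span of some weakly compact set is everything. -/
def IsWCG (X : Type*) [NormedAddCommGroup X] [NormedSpace ℝ X] : Prop :=
  ∃ K : Set X, IsWeaklyCompact K ∧ (Submodule.span ℝ K).topologicalClosure = ⊤

/-- A (norm closed) ideal: a closed linear subspace `Y` such that `|x| ≤ |y|` and `y ∈ Y`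
imply `x ∈ Y`. -/
structure IsClosedIdeal {X : Type*} [NormedAddCommGroup X] [Lattice X] [NormedSpace ℝ X]
    (Y : Submodule ℝ X) : Prop where
  isClosed : IsClosed (Y : Set X)
  solid : ∀ ⦃x y : X⦄, |x| ≤ |y| → y ∈ Y → x ∈ Y

/-- A (norm closed) band: a closed ideal containing the supremum of each of its subsets whose
supremum exists in the whole space. -/
structure IsClosedBand {X : Type*} [NormedAddCommGroup X] [Lattice X] [NormedSpace ℝ X]
    (Z : Submodule ℝ X) : Prop extends IsClosedIdeal Z where
  isLUB_mem : ∀ ⦃A : Set X⦄ ⦃s : X⦄, A ⊆ (Z : Set X) → IsLUB A s → s ∈ Z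

/-- The band `B(A)` generated by `A`: the smallest closed band containing `A`, obtained as the
intersection of all of them. -/
def bandGeneratedBy {X : Type*} [NormedAddCommGroup X] [Lattice X] [NormedSpace ℝ X]
    (A : Set X) : Submodule ℝ X :=
  sInf {Z : Submodule ℝ X | IsClosedBand Z ∧ A ⊆ (Z : Set X)}

theorem subset_bandGeneratedBy {X : Type*} [NormedAddCommGroup X] [Lattice X] [NormedSpace ℝ X]
    (A : Set X) : A ⊆ (bandGeneratedBy A : Set X) := by
  intro x hx
  exact (Submodule.mem_sInf).2 fun Z hZ => hZ.2 hx

theorem isClosedBand_bandGeneratedBy {X : Type*} [NormedAddCommGroup X] [Lattice X]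
    [NormedSpace ℝ X] (A : Set X) : IsClosedBand (bandGeneratedBy A) where
  isClosed := by
    unfold bandGeneratedBy
    rw [Submodule.coe_sInf]
    exact isClosed_biInter fun Z hZ => hZ.1.isClosed
  solid := fun _ _ hxy hy => (Submodule.mem_sInf).2 fun Z hZ =>
    hZ.1.solid hxy ((Submodule.mem_sInf).1 hy Z hZ)
  isLUB_mem := fun _ _ hB hs => (Submodule.mem_sInf).2 fun Z hZ =>
    hZ.1.isLUB_mem (fun _ hb => (Submodule.mem_sInf).1 (hB hb) Z hZ) hs

/-- Weakly compactly generated as a band: `X = B(K)` for some weakly compact set `K`. -/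
def IsBWCG (X : Type*) [NormedAddCommGroup X] [Lattice X] [NormedSpace ℝ X] : Prop :=
  ∃ K : Set X, IsWeaklyCompact K ∧ bandGeneratedBy K = ⊤

/-- Order continuity of the norm: every nonempty downward directed set with infimum `0`,
regarded as a decreasing net indexed by itself, converges to `0` in norm. -/
def IsOrderContinuous (X : Type*) [NormedAddCommGroup X] [Lattice X] : Prop :=
  ∀ S : Set X, S.Nonempty → DirectedOn (· ≥ ·) S → IsGLB S 0 →
    Tendsto (fun x : S => (x : X)) atBot (𝓝 0)

/-! A closed band is a closed subspace, so it contains the closed span of any set it contains; this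
gives WCG ⇒ BWCG.

For the converse, let `B(K) = X` with `K` weakly compact. Zorn's lemma gives a maximal disjoint
family `E` of positive elements of the solid hull of `K`. A nonzero `y ≥ 0` disjoint from `E` would
satisfy `|x| ⊓ y ≠ 0` for some `x ∈ K`, as otherwise `K` lies in the band of elements disjoint from
`y`; then `|x| ⊓ y` could be added to `E`. So `E` is maximal disjoint in all of `X`, and the
generating set is `{0}` together with the intervals `[0, e]`, `e ∈ E`.

It is weakly compact for two reasons. Each `[0, e]` is weakly compact: an ultrafilter limit is a
linear form on the dual lying between `0` and `e`, and order continuity puts such a form in `X`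
(`exists_eq_of_bidual`). And `E` is weakly null (`finite_setOf_le_of_disjoint`): if `h e ≥ ε` for
infinitely many `e ≤ |x|`, `x ∈ K`, then restricting `h` to the bands of these `e` gives functionals
that are absolutely summable at every point yet at least `ε` on points of `K`, which a gliding hump
excludes.

Its span is dense because the finite sums of `x ⊓ n e` increase in norm to some `s ≤ x`, and `x - s`
is disjoint from `E`. -/

/-! ### Elementary lattice and norm inequalities -/

section LatticeLemmas

theorem posPart_add_le {X : Type*} [AddCommGroup X] [Lattice X] [IsOrderedAddMonoid X] (x y : X) :
    (x + y)⁺ ≤ x⁺ + y⁺ :=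
  sup_le (add_le_add (le_posPart x) (le_posPart y))
    (add_nonneg (posPart_nonneg x) (posPart_nonneg y))

section Norm

variable {X : Type*} [NormedAddCommGroup X] [Lattice X] [IsOrderedAddMonoid X] [HasSolidNorm X]

theorem norm_le_norm_of_nonneg_of_le {x y : X} (hx : 0 ≤ x) (h : x ≤ y) : ‖x‖ ≤ ‖y‖ :=
  norm_le_norm_of_abs_le_abs (by rwa [abs_of_nonneg hx, abs_of_nonneg (hx.trans h)])

theorem norm_posPart_le_norm (x : X) : ‖x⁺‖ ≤ ‖x‖ := by
  rw [← norm_abs_eq_norm x]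
  exact norm_le_norm_of_nonneg_of_le (posPart_nonneg x) (sup_le (le_abs_self x) (abs_nonneg x))

end Norm

variable {X : Type*} [AddCommGroup X] [Lattice X] [Module ℝ X] [IsOrderedModule ℝ X]

theorem smul_inf_of_pos {c : ℝ} (hc : 0 < c) (x y : X) : c • (x ⊓ y) = c • x ⊓ c • y :=
  (OrderIso.smulRight (β := X) hc).map_inf x y

theorem smul_sup_of_pos {c : ℝ} (hc : 0 < c) (x y : X) : c • (x ⊔ y) = c • x ⊔ c • y :=
  (OrderIso.smulRight (β := X) hc).map_sup x y

theorem smul_posPart_of_pos {c : ℝ} (hc : 0 < c) (x : X) : (c • x)⁺ = c • x⁺ := by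
  rw [posPart_def, posPart_def, smul_sup_of_pos hc, smul_zero]

theorem abs_smul_of_pos {c : ℝ} (hc : 0 < c) (x : X) : |c • x| = c • |x| := by
  rw [abs, abs, smul_sup_of_pos hc, smul_neg]

end LatticeLemmas

/-! ### Hahn–Banach constructions of positive functionals -/

section Functionals

variable {X : Type*} [NormedAddCommGroup X] [NormedSpace ℝ X]

/-- Hahn–Banach: a bounded sublinear functional dominates a continuous linear functional that
agrees with it at a prescribed point. -/
theorem exists_dual_le_sublinear (p : X → ℝ) (C : ℝ)
    (hsmul : ∀ c : ℝ, 0 < c → ∀ z, p (c • z) = c * p z) (hadd : ∀ y z, p (y + z) ≤ p y + p z)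
    (hC : ∀ z, p z ≤ C * ‖z‖) (z₀ : X) :
    ∃ G : X →L[ℝ] ℝ, (∀ z, G z ≤ p z) ∧ G z₀ = p z₀ := by
  have h0 : p 0 = 0 := by
    have := hsmul 2 two_pos 0
    rw [smul_zero] at this
    linarith
  have hneg : ∀ z, -p (-z) ≤ p z := fun z => by
    have := hadd z (-z)
    rw [add_neg_cancel, h0] at this
    linarith
  have hwd : ∀ c : ℝ, c • z₀ = 0 → (RingHom.id ℝ) c • p z₀ = 0 := by
    intro c hc
    rcases smul_eq_zero.1 hc with h | h
    · simp [h]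
    · simp [h, h0]
  obtain ⟨G, hG, hGp⟩ := exists_extension_of_le_sublinear
    (LinearPMap.mkSpanSingleton' z₀ (p z₀) hwd) p hsmul hadd (by
      rintro ⟨x, hx⟩
      obtain ⟨c, rfl⟩ := Submodule.mem_span_singleton.1 hx
      rw [LinearPMap.mkSpanSingleton'_apply]
      simp only [RingHom.id_apply, smul_eq_mul]
      -- Homogeneity covers only positive scalars; for `c < 0` the bound comes from `-p (-w) ≤ p w`.
      rcases lt_trichotomy c 0 with hc | hc | hc
      · have h1 := hneg (c • z₀)
        rw [← neg_smul, hsmul (-c) (by linarith)] at h1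
        linarith
      · simp [hc, h0]
      · exact (hsmul c hc z₀).ge)
  refine ⟨G.mkContinuous C fun z => ?_, hGp, ?_⟩
  · rw [Real.norm_eq_abs, abs_le]
    have h1 := (hGp z).trans (hC z)
    have h2 := (hGp (-z)).trans (hC (-z))
    rw [map_neg, norm_neg] at h2
    constructor <;> linarith
  · have := hG ⟨z₀, Submodule.mem_span_singleton_self z₀⟩
    simp only at this
    rw [LinearMap.mkContinuous_apply, this]
    have h2 := LinearPMap.mkSpanSingleton'_apply z₀ (p z₀) hwd 1
    simp only [one_smul, RingHom.id_apply] at h2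
    exact h2 (Submodule.mem_span_singleton_self z₀)

/-- Hahn–Banach for the sublinear functional `z ↦ inf {r | R z r}` of a convex cone `R`. -/
theorem exists_dual_le_of_cone (R : X → ℝ → Prop) (C : ℝ)
    (hsmul : ∀ c : ℝ, 0 < c → ∀ z r, R z r → R (c • z) (c * r))
    (hadd : ∀ y z r s, R y r → R z s → R (y + z) (r + s))
    (hlow : ∀ z r, R z r → -(C * ‖z‖) ≤ r) (hup : ∀ z, ∃ r, R z r ∧ r ≤ C * ‖z‖) (z₀ : X) :
    ∃ G : X →L[ℝ] ℝ, (∀ z r, R z r → G z ≤ r) ∧ G z₀ = sInf {r | R z₀ r} := by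
  have hbdd : ∀ z, BddBelow {r | R z r} := fun z => ⟨_, fun r hr => hlow z r hr⟩
  have hne : ∀ z, {r | R z r}.Nonempty := fun z => (hup z).imp fun r hr => hr.1
  have hle : ∀ c : ℝ, 0 < c → ∀ z, sInf {r | R (c • z) r} ≤ c * sInf {r | R z r} := by
    intro c hc z
    rw [← div_le_iff₀' hc]
    refine le_csInf (hne z) fun r hr => ?_
    rw [div_le_iff₀' hc]
    exact csInf_le (hbdd _) (hsmul c hc z r hr)
  obtain ⟨G, hG, hGz⟩ := exists_dual_le_sublinear (fun z => sInf {r | R z r}) C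
    (fun c hc z => by
      refine le_antisymm (hle c hc z) ?_
      have := hle c⁻¹ (inv_pos.2 hc) (c • z)
      rw [inv_smul_smul₀ hc.ne', le_inv_mul_iff₀ hc] at this
      exact this)
    (fun y z => by
      rw [← sub_le_iff_le_add]
      refine le_csInf (hne y) fun r hr => ?_
      rw [sub_le_comm]
      refine le_csInf (hne z) fun s hs => ?_
      rw [sub_le_iff_le_add']
      exact csInf_le (hbdd _) (hadd y z r s hr hs))
    (fun z => by
      obtain ⟨r, hr, hrC⟩ := hup z
      exact (csInf_le (hbdd z) hr).trans hrC) z₀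
  exact ⟨G, fun z r hr => (hG z).trans (csInf_le (hbdd z) hr), hGz⟩

variable [Lattice X]

/-- A continuous linear functional which is nonnegative on the positive cone. -/
def IsPositiveFunctional (f : X →L[ℝ] ℝ) : Prop :=
  ∀ z, 0 ≤ z → 0 ≤ f z

theorem IsPositiveFunctional.add {f g : X →L[ℝ] ℝ} (hf : IsPositiveFunctional f)
    (hg : IsPositiveFunctional g) : IsPositiveFunctional (f + g) :=
  fun z hz => add_nonneg (hf z hz) (hg z hz)

theorem IsPositiveFunctional.smul {f : X →L[ℝ] ℝ} (hf : IsPositiveFunctional f) {c : ℝ}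
    (hc : 0 ≤ c) : IsPositiveFunctional (c • f) :=
  fun z hz => mul_nonneg hc (hf z hz)

variable [IsOrderedAddMonoid X]

theorem IsPositiveFunctional.mono {f : X →L[ℝ] ℝ} (hf : IsPositiveFunctional f) {x y : X}
    (h : x ≤ y) : f x ≤ f y := by
  have := hf (y - x) (sub_nonneg.2 h)
  rw [map_sub] at this
  linarith

variable [HasSolidNorm X] [IsOrderedModule ℝ X]

/-- Evaluation of a positive functional at a positive part is attained by a smaller positive
functional. -/
theorem IsPositiveFunctional.exists_apply_eq_apply_posPart {f : X →L[ℝ] ℝ}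
    (hf : IsPositiveFunctional f) (x : X) :
    ∃ g : X →L[ℝ] ℝ, IsPositiveFunctional g ∧ IsPositiveFunctional (f - g) ∧ g x = f x⁺ := by
  obtain ⟨g, hg, hgx⟩ := exists_dual_le_sublinear (fun z => f z⁺) ‖f‖
    (fun c hc z => by simp [smul_posPart_of_pos hc])
    (fun y z => by simpa using hf.mono (posPart_add_le y z))
    (fun z => (le_abs_self _).trans ((f.le_opNorm _).trans
      (mul_le_mul_of_nonneg_left (norm_posPart_le_norm z) (norm_nonneg f)))) x
  -- For `z ≥ 0`, the bound `g ≤ f (·⁺)` at `-z` gives `0 ≤ g z`, and at `z` gives `g z ≤ f z`.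
  refine ⟨g, fun z hz => ?_, fun z hz => ?_, hgx⟩
  · have := hg (-z)
    rw [posPart_eq_zero.2 (neg_nonpos.2 hz), map_zero, map_neg] at this
    linarith
  · have := hg z
    rw [posPart_of_nonneg hz] at this
    simpa using this

/-- The sublinear functional `z ↦ ‖z⁺‖` vanishes on the negative cone, so anything linear below it
is positive; one that agrees with it at `x - y` detects `(x - y)⁺`. -/
theorem le_of_forall_positiveFunctional {x y : X}
    (h : ∀ f : X →L[ℝ] ℝ, IsPositiveFunctional f → f x ≤ f y) : x ≤ y := by
  obtain ⟨g, hg, hgx⟩ := exists_dual_le_sublinear (fun z : X => ‖z⁺‖) 1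
    (fun c hc z => by simp [smul_posPart_of_pos hc, norm_smul, abs_of_pos hc])
    (fun y z => (norm_le_norm_of_nonneg_of_le (posPart_nonneg _) (posPart_add_le y z)).trans
      (norm_add_le _ _))
    (fun z => by simpa using norm_posPart_le_norm z) (x - y)
  have hpos : IsPositiveFunctional g := fun z hz => by
    have := hg (-z)
    rw [posPart_eq_zero.2 (neg_nonpos.2 hz), norm_zero, map_neg] at this
    linarith
  have h1 := h g hpos
  rw [map_sub] at hgx
  have h2 : (x - y)⁺ = 0 := norm_le_zero_iff.1 (by linarith)
  exact sub_nonpos.1 (posPart_eq_zero.1 h2)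

/-- Every continuous linear functional is a difference of positive ones. -/
theorem exists_positiveFunctional_sub_eq (f : X →L[ℝ] ℝ) :
    ∃ g : X →L[ℝ] ℝ, IsPositiveFunctional g ∧ IsPositiveFunctional (g - f) := by
  -- The pairs `(a, b) = (0, 0)` force `g ≥ 0` and the pairs `(0, b)` force `g b ≥ f b`. The cost
  -- `‖f‖ * ‖a‖` keeps the infimum finite. Only domination is needed, so the base point is `0`.
  obtain ⟨g, hg, -⟩ := exists_dual_le_of_cone
    (fun (z : X) r => ∃ a b : X, 0 ≤ a ∧ 0 ≤ b ∧ z ≤ a - b ∧ ‖f‖ * ‖a‖ - f b ≤ r) ‖f‖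
    (by
      rintro c hc z r ⟨a, b, ha, hb, hz, hr⟩
      refine ⟨c • a, c • b, smul_nonneg hc.le ha, smul_nonneg hc.le hb, ?_, ?_⟩
      · rw [← smul_sub]
        exact smul_le_smul_of_nonneg_left hz hc.le
      · rw [norm_smul, map_smul, Real.norm_eq_abs, abs_of_pos hc, smul_eq_mul]
        linarith [mul_le_mul_of_nonneg_left hr hc.le])
    (by
      rintro y z r s ⟨a, b, ha, hb, hz, hr⟩ ⟨a', b', ha', hb', hz', hs⟩
      refine ⟨a + a' , b + b', add_nonneg ha ha', add_nonneg hb hb', ?_, ?_⟩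
      · rw [add_sub_add_comm]
        exact add_le_add hz hz'
      · have h1 : ‖a + a'‖ ≤ ‖a‖ + ‖a'‖ := norm_add_le _ _
        have h2 := mul_le_mul_of_nonneg_left h1 (norm_nonneg f)
        rw [map_add]
        linarith)
    (by
      rintro z r ⟨a, b, ha, hb, hz, hr⟩
      have h1 : b ≤ a + (-z)⁺ := by
        have : b ≤ a + -z := by
          rw [← sub_eq_add_neg]
          exact le_sub_comm.1 hz
        exact this.trans (add_le_add_right (le_posPart _) _)
      have h2 : ‖b‖ ≤ ‖a‖ + ‖z‖ := (norm_le_norm_of_nonneg_of_le hb h1).trans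
        ((norm_add_le _ _).trans (add_le_add_right ((norm_posPart_le_norm _).trans_eq
          (norm_neg z)) _))
      have h3 := (le_abs_self _).trans (f.le_opNorm b)
      have h4 := mul_le_mul_of_nonneg_left h2 (norm_nonneg f)
      linarith)
    (fun z => ⟨_, ⟨z⁺, 0, posPart_nonneg z, le_rfl, by simpa using le_posPart z, le_rfl⟩, by
      simpa using mul_le_mul_of_nonneg_left (norm_posPart_le_norm z) (norm_nonneg f)⟩) 0
  refine ⟨g, fun z hz => ?_, fun z hz => ?_⟩
  · have := hg (-z) 0 ⟨0, 0, le_rfl, le_rfl, by simpa using hz, by simp⟩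
    rw [map_neg] at this
    linarith
  · have := hg (-z) (-f z) ⟨0, z, le_rfl, hz, by simp, by simp⟩
    rw [map_neg] at this
    simp only [sub_apply]
    linarith

end Functionals

/-! ### Norm convergence from order continuity -/

section OrderContinuity

variable {X : Type*} [NormedAddCommGroup X] [Lattice X] [IsOrderedAddMonoid X] [HasSolidNorm X]

variable [NormedSpace ℝ X]

/-- The Archimedean property: monotonicity of the norm gives `n * ‖w‖ ≤ ‖b‖` for all `n`. -/
theorem eq_zero_of_nonneg_of_forall_nsmul_le {w b : X} (hw : 0 ≤ w) (h : ∀ n : ℕ, n • w ≤ b) :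
    w = 0 := by
  by_contra hne
  obtain ⟨n, hn⟩ := exists_nat_gt (‖b‖ / ‖w‖)
  rw [div_lt_iff₀ (norm_pos_iff.2 hne)] at hn
  have h1 : ‖n • w‖ = n * ‖w‖ := by rw [← Nat.cast_smul_eq_nsmul ℝ, norm_smul]; simp
  rw [← h1] at hn
  exact hn.not_ge (norm_le_norm_of_nonneg_of_le (nsmul_nonneg hw n) (h n))

/-- The differences between upper bounds and elements of a bounded above set have infimum `0`. -/
theorem isGLB_upperBounds_sub_range {ι : Type*} [Nonempty ι] {f : ι → X}
    (hb : BddAbove (Set.range f)) :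
    IsGLB {d | ∃ u ∈ upperBounds (Set.range f), ∃ i, d = u - f i} 0 := by
  refine ⟨?_, fun w hw => ?_⟩
  · rintro _ ⟨u, hu, i, rfl⟩
    exact sub_nonneg.2 (hu ⟨i, rfl⟩)
  · have hw' : ∀ u ∈ upperBounds (Set.range f), ∀ i, w⁺ ≤ u - f i := fun u hu i =>
      sup_le (hw ⟨u, hu, i, rfl⟩) (sub_nonneg.2 (hu ⟨i, rfl⟩))
    obtain ⟨u, hu⟩ := hb
    -- Subtracting `w⁺` from an upper bound leaves an upper bound, so the subtraction can be
    -- repeated.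
    have hmem : ∀ n : ℕ, u - n • w⁺ ∈ upperBounds (Set.range f) := by
      intro n
      induction n with
      | zero => simpa using hu
      | succ n ih =>
        rintro _ ⟨i, rfl⟩
        have := hw' _ ih i
        rw [succ_nsmul, ← sub_sub]
        exact le_sub_comm.1 this
    have i : ι := Classical.arbitrary ι
    have h0 : w⁺ = 0 := eq_zero_of_nonneg_of_forall_nsmul_le (b := u - f i) (posPart_nonneg w)
      fun n => le_sub_comm.1 (hmem n ⟨i, rfl⟩)
    exact posPart_eq_zero.1 h0

variable [CompleteSpace X]

/-- In an order continuous Banach lattice, order bounded increasing nets converge in norm. -/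
theorem IsOrderContinuous.exists_tendsto_of_monotone (hX : IsOrderContinuous X) {ι : Type*}
    [Preorder ι] [IsDirectedOrder ι] [Nonempty ι] {f : ι → X} (hf : Monotone f)
    (hb : BddAbove (Set.range f)) : ∃ x, Tendsto f atTop (𝓝 x) := by
  -- No supremum is available yet, so order continuity is applied to the gaps `u - f i`. A small gap
  -- bounds `f j - f i` for all `j ≥ i`, which makes the net Cauchy.
  set T := {d | ∃ u ∈ upperBounds (Set.range f), ∃ i, d = u - f i} with hT
  have hTne : T.Nonempty := by
    obtain ⟨u, hu⟩ := hb
    exact ⟨_, u, hu, Classical.arbitrary ι, rfl⟩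
  have hTdir : DirectedOn (· ≥ ·) T := by
    rintro _ ⟨u, hu, i, rfl⟩ _ ⟨v, hv, j, rfl⟩
    obtain ⟨k, hik, hjk⟩ := exists_ge_ge i j
    exact ⟨_, ⟨u ⊓ v, fun x hx => le_inf (hu hx) (hv hx), k, rfl⟩,
      sub_le_sub inf_le_left (hf hik), sub_le_sub inf_le_right (hf hjk)⟩
  have hlim := hX T hTne hTdir (isGLB_upperBounds_sub_range hb)
  have : Nonempty T := hTne.to_subtype
  have : IsCodirectedOrder T := ⟨fun a b => by
    obtain ⟨c, hc, h1, h2⟩ := hTdir a a.2 b b.2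
    exact ⟨⟨c, hc⟩, h1, h2⟩⟩
  apply CompleteSpace.complete (f := map f atTop)
  rw [Metric.cauchy_iff]
  refine ⟨inferInstance, fun ε hε => ?_⟩
  obtain ⟨⟨_, u, hu, i, rfl⟩, hd⟩ :=
    eventually_atBot.1 (hlim.eventually (Metric.ball_mem_nhds 0 (half_pos hε)))
  have hnear : ∀ j, i ≤ j → ‖f j - f i‖ < ε / 2 := fun j hj => by
    have h1 := hd ⟨u - f i, u, hu, i, rfl⟩ le_rfl
    rw [dist_zero_right] at h1
    exact (norm_le_norm_of_nonneg_of_le (sub_nonneg.2 (hf hj))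
      (sub_le_sub_right (hu ⟨j, rfl⟩) _)).trans_lt h1
  refine ⟨f '' Set.Ici i, image_mem_map (Ici_mem_atTop i), ?_⟩
  rintro _ ⟨j, hj, rfl⟩ _ ⟨k, hk, rfl⟩
  have h1 := hnear j hj
  have h2 := hnear k hk
  rw [← dist_eq_norm] at h1 h2
  linarith [dist_triangle_right (f j) (f k) (f i)]

theorem IsOrderContinuous.exists_tendsto_of_antitone (hX : IsOrderContinuous X) {ι : Type*}
    [Preorder ι] [IsDirectedOrder ι] [Nonempty ι] {f : ι → X} (hf : Antitone f)
    (hb : BddBelow (Set.range f)) : ∃ x, Tendsto f atTop (𝓝 x) := by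
  obtain ⟨x, hx⟩ := hX.exists_tendsto_of_monotone (f := fun i => -f i)
    (fun i j h => neg_le_neg (hf h)) (by
      obtain ⟨b, hb⟩ := hb
      refine ⟨-b, ?_⟩
      rintro _ ⟨i, rfl⟩
      exact neg_le_neg (hb ⟨i, rfl⟩))
  exact ⟨-x, by simpa using hx.neg⟩

/-- An order bounded sequence with rapidly vanishing values under a positive functional `g` is
dominated by a decreasing sequence whose limit is annihilated by `g`. -/
theorem IsOrderContinuous.exists_null_of_apply_le_pow (hX : IsOrderContinuous X)
    {g : X →L[ℝ] ℝ} (hg : IsPositiveFunctional g) {y : X} {v : ℕ → X} (hv0 : ∀ n, 0 ≤ v n)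
    (hvy : ∀ n, v n ≤ y) (hgv : ∀ n, g (v n) ≤ (1 / 2) ^ n) :
    ∃ z, 0 ≤ z ∧ z ≤ y ∧ g z = 0 ∧ (z = 0 → Tendsto v atTop (𝓝 0)) := by
  -- `z N` will be the supremum of the tail from `N`; the element sought is the limit of the
  -- decreasing sequence `z N`, the order limit superior of `v`.
  have hlim : ∀ N, ∃ z, Tendsto (partialSups fun k => v (N + k)) atTop (𝓝 z) := fun N =>
    hX.exists_tendsto_of_monotone (partialSups _).monotone
      ⟨y, by rintro _ ⟨k, rfl⟩; exact partialSups_le _ _ _ fun i _ => hvy _⟩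
  choose z hz using hlim
  have hlub : ∀ N, IsLUB (Set.range fun k => v (N + k)) (z N) := fun N => by
    have := isLUB_of_tendsto_atTop (partialSups fun k => v (N + k)).monotone (hz N)
    rwa [IsLUB, upperBounds_range_partialSups] at this
  have hvz : ∀ N, v N ≤ z N := fun N => (hlub N).1 ⟨0, rfl⟩
  have hz0 : ∀ N, 0 ≤ z N := fun N => (hv0 N).trans (hvz N)
  have hzy : ∀ N, z N ≤ y := fun N => (hlub N).2 (by rintro _ ⟨k, rfl⟩; exact hvy _)
  have hanti : Antitone z := antitone_nat_of_succ_le fun N => (hlub (N + 1)).2 (by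
    rintro _ ⟨k, rfl⟩
    exact (hlub N).1 ⟨1 + k, by simp [add_assoc]⟩)
  have hgz : ∀ N, g (z N) ≤ 2 * (1 / 2) ^ N := by
    intro N
    refine le_of_tendsto ((g.continuous.tendsto _).comp (hz N)) (Eventually.of_forall fun M => ?_)
    -- The right side is the finite geometric sum of `(1 / 2) ^ (N + i)` over `i ≤ M`; the
    -- subtracted term lets the induction close.
    have h1 : ∀ M, g (partialSups (fun k => v (N + k)) M)
        ≤ 2 * (1 / 2) ^ N - (1 / 2) ^ (N + M) := by
      intro M
      induction M with
      | zero => have := hgv N; simp; simp at this; linarith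
      | succ M ih =>
        rw [partialSups_add_one]
        have h2 : partialSups (fun k => v (N + k)) M ⊔ v (N + (M + 1))
            ≤ partialSups (fun k => v (N + k)) M + v (N + (M + 1)) :=
          sup_le (le_add_of_nonneg_right (hv0 _)) (le_add_of_nonneg_left
            ((hv0 _).trans (le_partialSups (fun k => v (N + k)) M)))
        have h3 := hg.mono h2
        rw [map_add] at h3
        have h4 := hgv (N + (M + 1))
        have h5 : ((1 : ℝ) / 2) ^ (N + M) = 2 * (1 / 2) ^ (N + (M + 1)) := by ring
        linarith
    exact (h1 M).trans (sub_le_self _ (by positivity))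
  obtain ⟨w, hw⟩ := hX.exists_tendsto_of_antitone hanti ⟨0, by rintro _ ⟨N, rfl⟩; exact hz0 N⟩
  have hw0 : 0 ≤ w := ge_of_tendsto hw (Eventually.of_forall hz0)
  refine ⟨w, hw0, le_of_tendsto hw (Eventually.of_forall hzy), le_antisymm ?_ (hg w hw0), ?_⟩
  · have h1 : Tendsto (fun N : ℕ => 2 * ((1 : ℝ) / 2) ^ N) atTop (𝓝 (2 * 0)) :=
      (tendsto_pow_atTop_nhds_zero_of_lt_one (by norm_num) (by norm_num)).const_mul 2
    rw [mul_zero] at h1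
    exact le_of_tendsto_of_tendsto' ((g.continuous.tendsto _).comp hw) h1 hgz
  · rintro rfl
    exact squeeze_zero_norm (fun N => norm_le_norm_of_nonneg_of_le (hv0 N) (hvz N))
      (by simpa using hw.norm)

/-- The elements of `[0, e]` annihilated by a positive functional have a largest one. -/
theorem IsOrderContinuous.exists_isGreatest_null (hX : IsOrderContinuous X) {g : X →L[ℝ] ℝ}
    (hg : IsPositiveFunctional g) {e : X} (he : 0 ≤ e) :
    ∃ z, IsGreatest {z | 0 ≤ z ∧ z ≤ e ∧ g z = 0} z := by
  set S := {z | 0 ≤ z ∧ z ≤ e ∧ g z = 0}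
  have : Nonempty S := ⟨⟨0, le_rfl, he, map_zero g⟩⟩
  have : IsDirectedOrder S := ⟨by
    rintro ⟨a, ha0, hae, hga⟩ ⟨b, hb0, hbe, hgb⟩
    refine ⟨⟨a ⊔ b, ha0.trans le_sup_left, sup_le hae hbe,
      le_antisymm ?_ (hg _ (ha0.trans le_sup_left))⟩, le_sup_left (a := a) (b := b),
      le_sup_right (a := a) (b := b)⟩
    have := hg.mono (sup_le (le_add_of_nonneg_right hb0) (le_add_of_nonneg_left ha0) :
      a ⊔ b ≤ a + b)
    rwa [map_add, hga, hgb, add_zero] at this⟩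
  have hmono : Monotone (fun s : S => (s : X)) := fun a b h => h
  obtain ⟨z, hz⟩ := hX.exists_tendsto_of_monotone hmono
    ⟨e, by rintro _ ⟨s, rfl⟩; exact s.2.2.1⟩
  refine ⟨z, ⟨ge_of_tendsto hz (Eventually.of_forall fun s => s.2.1),
    le_of_tendsto hz (Eventually.of_forall fun s => s.2.2.1), ?_⟩, fun s hs => ?_⟩
  · refine tendsto_nhds_unique ((g.continuous.tendsto z).comp hz) ?_
    exact tendsto_const_nhds.congr fun s => s.2.2.2.symm
  · exact (isLUB_of_tendsto_atTop hmono hz).1 ⟨⟨s, hs⟩, rfl⟩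

end OrderContinuity

/-! ### Weak compactness through ultrafilters -/

section WeakCompactness

variable {X : Type*} [NormedAddCommGroup X] [NormedSpace ℝ X]

/-- Weak convergence is tested on each functional separately, so compactness can be stated on `X`
itself, where ultrafilter limits of functionals are linear in the functional. -/
theorem isWeaklyCompact_iff_ultrafilter {K : Set X} :
    IsWeaklyCompact K ↔ ∀ U : Ultrafilter X, K ∈ U →
      ∃ x ∈ K, ∀ f : X →L[ℝ] ℝ, Tendsto f U (𝓝 (f x)) := by
  have hle : ∀ (U : Ultrafilter X) (x : X), (U.map (toWeakSpace ℝ X) : Filter (WeakSpace ℝ X)) ≤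
      𝓝 (toWeakSpace ℝ X x) ↔ ∀ f : X →L[ℝ] ℝ, Tendsto f U (𝓝 (f x)) := by
    intro U x
    have := WeakBilin.tendsto_iff_forall_eval_tendsto (l := (U : Filter X))
      (f := fun y => toWeakSpace ℝ X y) (x := toWeakSpace ℝ X x) (topDualPairing ℝ X).flip
      (by
        intro a b hab
        by_contra hne
        obtain ⟨f, hf⟩ := SeparatingDual.exists_separating_of_ne (R := ℝ) hne
        exact hf (LinearMap.congr_fun hab f))
    exact this
  rw [IsWeaklyCompact, isCompact_iff_ultrafilter_le_nhds]
  constructor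
  · intro h U hU
    obtain ⟨_, ⟨x, hx, rfl⟩, hUx⟩ := h (U.map (toWeakSpace ℝ X))
      (le_principal_iff.2 (image_mem_map hU))
    exact ⟨x, hx, (hle U x).1 hUx⟩
  · intro h V hV
    set U := V.map (toWeakSpace ℝ X).symm with hUdef
    have hVU : U.map (toWeakSpace ℝ X) = V := by
      rw [hUdef, Ultrafilter.map_map]
      have : (toWeakSpace ℝ X : X → WeakSpace ℝ X) ∘ (toWeakSpace ℝ X).symm = id := by
        ext x
        simp
      rw [this, Ultrafilter.map_id]
    have hU : K ∈ U := by
      rw [hUdef, Ultrafilter.mem_map]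
      filter_upwards [le_principal_iff.1 hV] with y hy
      obtain ⟨x, hx, rfl⟩ := hy
      simpa using hx
    obtain ⟨x, hx, hUx⟩ := h U hU
    exact ⟨_, ⟨x, hx, rfl⟩, hVU ▸ (hle U x).2 hUx⟩

end WeakCompactness

/-! ### Weak compactness of order intervals -/

section Intervals

variable {X : Type*} [NormedAddCommGroup X] [Lattice X] [NormedSpace ℝ X]

/-- If `θ` is dominated by evaluation at `e` and positive at `f`, then some positive functional
`g` with `0 < θ g` is such that `θ` is nonnegative on all of `[0, g]`. -/
theorem exists_positiveFunctional_forall_le_nonneg [IsOrderedAddMonoid X] [CompleteSpace X]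
    {e : X} (he : 0 ≤ e)
    (θ : (X →L[ℝ] ℝ) →ₗ[ℝ] ℝ) {C : ℝ} (hθ : ∀ h, IsPositiveFunctional h → |θ h| ≤ C * h e)
    {f : X →L[ℝ] ℝ} (hf : IsPositiveFunctional f) (hθf : 0 < θ f) :
    ∃ g, IsPositiveFunctional g ∧ 0 < θ g ∧
      ∀ h, IsPositiveFunctional h → IsPositiveFunctional (g - h) → 0 ≤ θ h := by
  -- Exhaustion as for the Hahn decomposition of a signed measure: `q ≤ p` is chosen with `θ q`
  -- within `1 / (n + 1)` of the supremum, so removing `h` from `q` cannot raise `θ` by more than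
  -- that.
  have step : ∀ (n : ℕ) (p : {f : X →L[ℝ] ℝ // IsPositiveFunctional f}),
      ∃ q : {f : X →L[ℝ] ℝ // IsPositiveFunctional f}, IsPositiveFunctional (p.1 - q.1) ∧
        θ p ≤ θ q ∧ ∀ h, IsPositiveFunctional h → IsPositiveFunctional (q.1 - h) →
          -(1 / ((n : ℝ) + 1)) ≤ θ h := by
    rintro n ⟨p, hp⟩
    set S := {r | ∃ q, IsPositiveFunctional q ∧ IsPositiveFunctional (p - q) ∧ θ p ≤ θ q ∧ r = θ q}
    have hC : 0 ≤ |C| := abs_nonneg C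
    have hbdd : BddAbove S := by
      refine ⟨|C| * p e, ?_⟩
      rintro _ ⟨q, hq, hpq, -, rfl⟩
      have h1 := (le_abs_self _).trans (hθ q hq)
      have h2 := mul_le_mul_of_nonneg_right (le_abs_self C) (hq e he)
      have h3 := mul_le_mul_of_nonneg_left (show q e ≤ p e from sub_nonneg.1 (hpq e he)) hC
      linarith
    have hne : S.Nonempty := ⟨_, p, hp, fun z _ => by simp, le_rfl, rfl⟩
    have hn : (0 : ℝ) < 1 / ((n : ℝ) + 1) := by positivity
    obtain ⟨_, ⟨q, hq, hpq, hθpq, rfl⟩, hlt⟩ := exists_lt_of_lt_csSup hne (sub_lt_self (sSup S) hn)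
    refine ⟨⟨q, hq⟩, hpq, hθpq, fun h hh hqh => ?_⟩
    have h1 : θ (q - h) < θ q + 1 / ((n : ℝ) + 1) := by
      by_cases hcase : θ p ≤ θ (q - h)
      · have := le_csSup hbdd ⟨q - h, hqh, by
          have := hpq.add hh
          rwa [show p - q + h = p - (q - h) by abel] at this, hcase, rfl⟩
        linarith
      · linarith
    rw [map_sub] at h1
    linarith
  choose nxt hdec hinc hlow using step
  set F : ℕ → {f : X →L[ℝ] ℝ // IsPositiveFunctional f} := fun n =>
    Nat.rec ⟨f, hf⟩ (fun n p => nxt n p) n with hF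
  have hFsucc : ∀ n, F (n + 1) = nxt n (F n) := fun n => rfl
  have hanti : ∀ z, 0 ≤ z → Antitone fun n => (F n).1 z := fun z hz =>
    antitone_nat_of_succ_le fun n => sub_nonneg.1 (hdec n (F n) z hz)
  have hconv : ∀ z, 0 ≤ z → ∃ r, Tendsto (fun n => (F n).1 z) atTop (𝓝 r) := fun z hz =>
    ⟨_, tendsto_atTop_ciInf (hanti z hz) ⟨0, by rintro _ ⟨n, rfl⟩; exact (F n).2 z hz⟩⟩
  have hconv' : ∀ z, ∃ r, Tendsto (fun n => (F n).1 z) atTop (𝓝 r) := fun z => by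
    obtain ⟨r, hr⟩ := hconv z⁺ (posPart_nonneg z)
    obtain ⟨s, hs⟩ := hconv z⁻ (negPart_nonneg z)
    refine ⟨r - s, (hr.sub hs).congr fun n => ?_⟩
    rw [← map_sub, posPart_sub_negPart]
  choose φ hφ using hconv'
  -- The pointwise limit of the decreasing sequence is continuous by Banach–Steinhaus.
  set g : X →L[ℝ] ℝ := continuousLinearMapOfTendsto (fun n => (F n).1) (f := φ)
    (tendsto_pi_nhds.2 hφ) with hg
  have hgF : ∀ z, Tendsto (fun n => (F n).1 z) atTop (𝓝 (g z)) := hφ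
  have hFg : ∀ n, IsPositiveFunctional ((F n).1 - g) := fun n z hz =>
    sub_nonneg.2 ((hanti z hz).le_of_tendsto (hgF z) n)
  have hθF : ∀ n, θ f ≤ θ (F n).1 := fun n => by
    induction n with
    | zero => exact le_rfl
    | succ n ih => exact ih.trans (hinc n (F n))
  refine ⟨g, fun z hz => ge_of_tendsto (hgF z) (Eventually.of_forall fun n => (F n).2 z hz),
    hθf.trans_le ?_, fun h hh hgh => ?_⟩
  -- Domination by evaluation at `e` makes `θ` continuous along this sequence: `θ (F n - g) ≤ C * (F
  -- n - g) e → 0`.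
  · have h1 : Tendsto (fun n => θ g + C * ((F n).1 e - g e)) atTop (𝓝 (θ g + C * (g e - g e))) :=
      (((hgF e).sub_const _).const_mul C).const_add _
    rw [sub_self, mul_zero, add_zero] at h1
    refine ge_of_tendsto h1 (Eventually.of_forall fun n => ?_)
    have h2 := (le_abs_self _).trans (hθ _ (hFg n))
    have h3 := hθF n
    rw [map_sub, sub_apply] at h2
    linarith
  · have h1 : Tendsto (fun n : ℕ => -(1 / ((n : ℝ) + 1))) atTop (𝓝 (-0)) :=
      tendsto_one_div_add_atTop_nhds_zero_nat.neg
    rw [neg_zero] at h1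
    refine le_of_tendsto h1 (Eventually.of_forall fun n => hlow n (F n) h hh ?_)
    have := (hFg (n + 1)).add hgh
    rwa [sub_add_sub_cancel, hFsucc] at this

variable [IsOrderedAddMonoid X] [HasSolidNorm X] [IsOrderedModule ℝ X]

/-- If `h ≤ n g + ε` on the interval `[0, y]`, then the meet of the functionals `h` and `n g`
is at least `h y - ε` at `y`. -/
theorem exists_positiveFunctional_le_both {g h : X →L[ℝ] ℝ}
    (hg : IsPositiveFunctional g) (hh : IsPositiveFunctional h) {y : X} (hy : 0 ≤ y)
    {ε : ℝ} (hv : ∀ v, 0 ≤ v → v ≤ y → h v ≤ g v + ε) :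
    ∃ k, IsPositiveFunctional k ∧ IsPositiveFunctional (h - k) ∧ IsPositiveFunctional (g - k) ∧
      h y - ε ≤ k y := by
  have hnonneg : ∀ z : X, ∀ r, (∃ u v : X, 0 ≤ u ∧ 0 ≤ v ∧ z ≤ u + v ∧ h u + g v ≤ r) → 0 ≤ r := by
    rintro z r ⟨u, v, hu, hv, -, hr⟩
    linarith [hh u hu, hg v hv]
  -- The infimum of `h u + g v` over `u + v ≥ y` is the Riesz–Kantorovich formula for `(h ⊓ g) y`.
  obtain ⟨k, hk, hky⟩ := exists_dual_le_of_cone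
    (fun (z : X) r => ∃ u v : X, 0 ≤ u ∧ 0 ≤ v ∧ z ≤ u + v ∧ h u + g v ≤ r) ‖h‖
    (by
      rintro c hc z r ⟨u, v, hu, hv, hz, hr⟩
      refine ⟨c • u, c • v, smul_nonneg hc.le hu, smul_nonneg hc.le hv, ?_, ?_⟩
      · rw [← smul_add]
        exact smul_le_smul_of_nonneg_left hz hc.le
      · rw [map_smul, map_smul, ← smul_add]
        exact mul_le_mul_of_nonneg_left hr hc.le)
    (by
      rintro z z' r s ⟨u, v, hu, hv, hz, hr⟩ ⟨u', v', hu', hv', hz', hs⟩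
      refine ⟨u + u', v + v', add_nonneg hu hu', add_nonneg hv hv', ?_, ?_⟩
      · rw [add_add_add_comm]
        exact add_le_add hz hz'
      · rw [map_add, map_add]
        linarith)
    (fun z r hr => (neg_nonpos.2 (by positivity)).trans (hnonneg z r hr))
    (fun z => ⟨h z⁺, ⟨z⁺, 0, posPart_nonneg z, le_rfl, by simpa using le_posPart z, by simp⟩,
      (le_abs_self _).trans ((h.le_opNorm _).trans
        (mul_le_mul_of_nonneg_left (norm_posPart_le_norm z) (norm_nonneg h)))⟩) y
  refine ⟨k, fun z hz => ?_, fun z hz => ?_, fun z hz => ?_, ?_⟩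
  · have := hk (-z) 0 ⟨0, 0, le_rfl, le_rfl, by simpa using hz, by simp⟩
    rw [map_neg] at this
    linarith
  · exact sub_nonneg.2 (hk z _ ⟨z, 0, hz, le_rfl, by simp, by simp⟩)
  · exact sub_nonneg.2 (hk z _ ⟨0, z, le_rfl, hz, by simp, by simp⟩)
  · rw [hky]
    refine le_csInf ⟨_, y, 0, hy, le_rfl, by simp, le_rfl⟩ ?_
    rintro r ⟨u, v, hu, hv0, hz, hr⟩
    -- Cutting `v` down to `v ⊓ y` brings it into `[0, y]`, and `u + v ⊓ y` still dominates `y`.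
    have h1 := hv (v ⊓ y) (le_inf hv0 hy) inf_le_right
    have h2 := hg.mono (inf_le_left : v ⊓ y ≤ v)
    have h3 : y ≤ u + v ⊓ y := by
      rw [add_inf]
      exact le_inf hz (le_add_of_nonneg_left hu)
    have h4 := hh.mono h3
    rw [map_add] at h4
    linarith

variable [CompleteSpace X]

/-- A nonzero positive element of the bidual lying below an element of `X` dominates a nonzero
positive element of `X`. -/
theorem IsOrderContinuous.exists_pos_le_of_bidual (hX : IsOrderContinuous X) {e : X} (he : 0 ≤ e)
    (ψ : (X →L[ℝ] ℝ) →ₗ[ℝ] ℝ) (hψ0 : ∀ h, IsPositiveFunctional h → 0 ≤ ψ h)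
    (hψe : ∀ h, IsPositiveFunctional h → ψ h ≤ h e)
    {f : X →L[ℝ] ℝ} (hf : IsPositiveFunctional f) (hψf : 0 < ψ f) :
    ∃ y, 0 ≤ y ∧ y ≠ 0 ∧ ∀ h, IsPositiveFunctional h → h y ≤ ψ h := by
  have hfe : 0 < f e := hψf.trans_le (hψe f hf)
  -- `t` is small enough that `θ = ψ - t e` is still positive at `f`. On the part where `θ ≥ 0`, `ψ`
  -- dominates `t e`; the element sought is `t` times a piece of `e`.
  obtain ⟨t, ht, htf⟩ : ∃ t : ℝ, 0 < t ∧ t * f e < ψ f :=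
    ⟨ψ f / (2 * f e), by positivity, by field_simp; norm_num⟩
  let θ : (X →L[ℝ] ℝ) →ₗ[ℝ] ℝ := ψ - t • (ContinuousLinearMap.apply ℝ ℝ e).toLinearMap
  have hθ : ∀ h, θ h = ψ h - t * h e := fun h => rfl
  obtain ⟨g, hg, hθg, hglow⟩ := exists_positiveFunctional_forall_le_nonneg he θ (C := 1 + t)
    (fun h hh => by
      have h1 := hψ0 h hh
      have h2 := hψe h hh
      have h3 := mul_nonneg ht.le (hh e he)
      rw [hθ, abs_le]
      constructor <;> linarith) hf (by rw [hθ]; linarith)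
  have hge : 0 < g e := by
    have h1 := mul_nonneg ht.le (hg e he)
    have h2 := hψe g hg
    rw [hθ] at hθg
    linarith
  -- Removing the largest `g`-null part of `e` makes `g` strictly positive on the nonzero elements
  -- of `[0, e - z₀]`.
  obtain ⟨z₀, ⟨hz₀, hz₀e, hgz₀⟩, hmax⟩ := hX.exists_isGreatest_null hg he
  have hy0 : 0 ≤ e - z₀ := sub_nonneg.2 hz₀e
  have hnull : ∀ z, 0 ≤ z → z ≤ e - z₀ → g z = 0 → z = 0 := fun z hz hze hgz => by
    have := hmax ⟨add_nonneg hz₀ hz, le_sub_iff_add_le'.1 hze, by rw [map_add, hgz₀, hgz, add_zero]⟩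
    exact le_antisymm (by simpa using this) hz
  -- Absolute continuity of `h` with respect to `g`: otherwise there are `v n` with `g (v n)` tiny
  -- and `h (v n) ≥ ε`, but their order limit superior is `g`-null, hence `0`, and `v n → 0` in
  -- norm.
  have hac : ∀ h, IsPositiveFunctional h → ∀ ε : ℝ, 0 < ε → ∃ n : ℕ, 0 < n ∧
      ∀ v, 0 ≤ v → v ≤ e - z₀ → h v ≤ n * g v + ε := by
    intro h hh ε hε
    by_contra! hcon
    have hseq : ∀ n : ℕ, ∃ v, 0 ≤ v ∧ v ≤ e - z₀ ∧ g v ≤ (1 / 2) ^ n ∧ ε ≤ h v := by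
      intro n
      -- Failure at `N` gives `N * g v < h v ≤ h (e - z₀)`, so this `N` forces `g v ≤ (1 / 2) ^ n`.
      obtain ⟨N, hN⟩ := exists_nat_gt (h (e - z₀) * 2 ^ n)
      have hNpos : (0 : ℝ) < N :=
        (mul_nonneg (hh _ hy0) (by positivity)).trans_lt hN
      obtain ⟨v, hv0, hve, hv⟩ := hcon N (by exact_mod_cast hNpos)
      refine ⟨v, hv0, hve, ?_, ?_⟩
      · have h1 := hh.mono hve
        have h2 : (N : ℝ) * g v ≤ N * (1 / 2) ^ n := by
          have h3 : h (e - z₀) = h (e - z₀) * 2 ^ n * (1 / 2) ^ n := by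
            rw [mul_assoc, ← mul_pow]; norm_num
          have h4 := mul_le_mul_of_nonneg_right hN.le (by positivity : (0 : ℝ) ≤ (1 / 2) ^ n)
          linarith
        exact le_of_mul_le_mul_left h2 hNpos
      · linarith [mul_nonneg hNpos.le (hg v hv0)]
    choose v hv0 hve hgv hhv using hseq
    obtain ⟨z, hz0, hze, hgz, hlim⟩ := hX.exists_null_of_apply_le_pow hg hv0 hve hgv
    have h1 := (h.continuous.tendsto 0).comp (hlim (hnull z hz0 hze hgz))
    rw [map_zero] at h1
    exact hε.not_ge (ge_of_tendsto h1 (Eventually.of_forall hhv))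
  refine ⟨t • (e - z₀), smul_nonneg ht.le hy0, fun h0 => ?_, fun h hh => ?_⟩
  · have h1 := congrArg g ((smul_eq_zero.1 h0).resolve_left ht.ne')
    rw [map_sub, hgz₀, map_zero] at h1
    linarith
  · refine le_of_forall_pos_le_add fun ε hε => ?_
    obtain ⟨n, hn, hv⟩ := hac h hh (ε / t) (by positivity)
    have hn' : (0 : ℝ) < n := by exact_mod_cast hn
    -- `k` plays the role of `h ⊓ n g`. As `n⁻¹ k ≤ g`, `θ k ≥ 0`, whence `ψ h ≥ ψ k ≥ t * k e ≥ t *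
    -- h (e - z₀) - ε`.
    obtain ⟨k, hk, hhk, hgk, hky⟩ := exists_positiveFunctional_le_both (hg.smul hn'.le) hh hy0 hv
    have h1 : 0 ≤ θ ((n : ℝ)⁻¹ • k) := hglow _ (hk.smul (by positivity)) (by
      have := hgk.smul (inv_nonneg.2 hn'.le)
      rwa [smul_sub, inv_smul_smul₀ hn'.ne'] at this)
    rw [map_smul, smul_eq_mul] at h1
    have h2 := nonneg_of_mul_nonneg_right h1 (by positivity)
    rw [hθ] at h2
    have h3 := hψ0 _ hhk
    rw [map_sub] at h3
    have h4 := mul_le_mul_of_nonneg_left (hky.trans (hk.mono (sub_le_self e hz₀))) ht.le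
    rw [mul_sub, mul_div_cancel₀ _ ht.ne'] at h4
    rw [map_smul, smul_eq_mul]
    linarith

/-- In an order continuous Banach lattice, every element of the bidual lying between `0` and an
element `e` of `X` belongs to `X`. -/
theorem IsOrderContinuous.exists_eq_of_bidual (hX : IsOrderContinuous X) {e : X} (he : 0 ≤ e)
    (ψ : (X →L[ℝ] ℝ) →ₗ[ℝ] ℝ) (hψ0 : ∀ h, IsPositiveFunctional h → 0 ≤ ψ h)
    (hψe : ∀ h, IsPositiveFunctional h → ψ h ≤ h e) :
    ∃ x, 0 ≤ x ∧ x ≤ e ∧ ∀ h, IsPositiveFunctional h → ψ h = h x := by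
  set D := {y : X | 0 ≤ y ∧ ∀ h, IsPositiveFunctional h → h y ≤ ψ h}
  have hDe : ∀ y ∈ D, y ≤ e := fun y hy =>
    le_of_forall_positiveFunctional fun h hh => (hy.2 h hh).trans (hψe h hh)
  have : Nonempty D := ⟨⟨0, le_rfl, fun h hh => by simpa using hψ0 h hh⟩⟩
  have : IsDirectedOrder D := ⟨by
    rintro ⟨a, ha0, ha⟩ ⟨b, hb0, hb⟩
    refine ⟨⟨a ⊔ b, ha0.trans le_sup_left, fun h hh => ?_⟩, le_sup_left (a := a) (b := b),
      le_sup_right (a := a) (b := b)⟩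
    -- Split `h = (h - k) + k` with `k (b - a) = h (b - a)⁺`. Then `h (a ⊔ b) = (h - k) a + k b`,
    -- and each term is bounded by `ψ`.
    obtain ⟨k, hk, hhk, hkab⟩ := hh.exists_apply_eq_apply_posPart (b - a)
    have h1 : a ⊔ b = a + (b - a)⁺ := by
      rw [posPart_def, add_sup, add_sub_cancel, add_zero, sup_comm]
    have h2 := ha _ hhk
    have h3 := hb _ hk
    rw [map_sub, sub_apply] at h2
    rw [map_sub] at hkab
    rw [h1, map_add]
    linarith⟩
  have hmono : Monotone (fun s : D => (s : X)) := fun a b h => h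
  obtain ⟨x, hx⟩ := hX.exists_tendsto_of_monotone hmono
    ⟨e, by rintro _ ⟨s, rfl⟩; exact hDe s s.2⟩
  have hlub := isLUB_of_tendsto_atTop hmono hx
  have hx0 : 0 ≤ x := ge_of_tendsto hx (Eventually.of_forall fun s => s.2.1)
  have hxψ : ∀ h, IsPositiveFunctional h → h x ≤ ψ h := fun h hh =>
    le_of_tendsto ((h.continuous.tendsto x).comp hx) (Eventually.of_forall fun s => s.2.2 h hh)
  refine ⟨x, hx0, hDe x ⟨hx0, hxψ⟩, fun h hh => ?_⟩
  by_contra hne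
  have hlt : h x < ψ h := lt_of_le_of_ne (hxψ h hh) (Ne.symm hne)
  obtain ⟨y, hy0, hyne, hy⟩ := hX.exists_pos_le_of_bidual he
    (ψ - (ContinuousLinearMap.apply ℝ ℝ x).toLinearMap)
    (fun k hk => sub_nonneg.2 (hxψ k hk))
    (fun k hk => (sub_le_self _ (hk x hx0)).trans (hψe k hk)) hh (sub_pos.2 hlt)
  have h1 : x + y ∈ D := ⟨add_nonneg hx0 hy0, fun k hk => by
    have : k y ≤ ψ k - k x := hy k hk
    rw [map_add]
    linarith⟩
  have h2 : x + y ≤ x := hlub.1 ⟨⟨x + y, h1⟩, rfl⟩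
  exact hyne (le_antisymm (by simpa using h2) hy0)

/-- Order intervals of an order continuous Banach lattice are weakly compact. -/
theorem IsOrderContinuous.isWeaklyCompact_Icc (hX : IsOrderContinuous X) {e : X} (he : 0 ≤ e) :
    IsWeaklyCompact (Set.Icc 0 e) := by
  rw [isWeaklyCompact_iff_ultrafilter]
  intro U hU
  have hconv : ∀ f : X →L[ℝ] ℝ, ∃ r, Tendsto f U (𝓝 r) := by
    intro f
    have hmem : Set.Icc (-(‖f‖ * ‖e‖)) (‖f‖ * ‖e‖) ∈ U.map f := by
      rw [Ultrafilter.mem_map]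
      filter_upwards [hU] with x hx
      exact abs_le.1 ((f.le_opNorm x).trans
        (mul_le_mul_of_nonneg_left (norm_le_norm_of_nonneg_of_le hx.1 hx.2) (norm_nonneg f)))
    obtain ⟨r, -, hr⟩ := isCompact_Icc.ultrafilter_le_nhds (U.map f) (le_principal_iff.2 hmem)
    exact ⟨r, hr⟩
  choose φ hφ using hconv
  let ψ : (X →L[ℝ] ℝ) →ₗ[ℝ] ℝ :=
    { toFun := φ
      map_add' := fun f g => tendsto_nhds_unique (hφ (f + g)) ((hφ f).add (hφ g))
      map_smul' := fun c f => tendsto_nhds_unique (hφ (c • f)) ((hφ f).const_mul c) }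
  obtain ⟨x, hx0, hxe, hx⟩ := hX.exists_eq_of_bidual he ψ
    (fun h hh => ge_of_tendsto (hφ h) (by filter_upwards [hU] with z hz using hh z hz.1))
    (fun h hh => le_of_tendsto (hφ h) (by filter_upwards [hU] with z hz using hh.mono hz.2))
  refine ⟨x, ⟨hx0, hxe⟩, fun f => ?_⟩
  obtain ⟨g, hg, hgf⟩ := exists_positiveFunctional_sub_eq f
  have h1 := (hφ g).sub (hφ (g - f))
  have h2 : φ g - φ (g - f) = f x := by
    rw [show φ g = g x from hx g hg, show φ (g - f) = (g - f) x from hx _ hgf]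
    simp
  rw [h2] at h1
  exact h1.congr fun z => by simp

end Intervals

/-! ### The gliding hump -/

section GlidingHump

variable {X : Type*} [NormedAddCommGroup X] [NormedSpace ℝ X] [CompleteSpace X]

/-- A gliding hump argument: on a weakly compact set, a sequence of functionals which is
absolutely summable at every point cannot stay bounded away from zero. -/
theorem IsWeaklyCompact.false_of_forall_le {K : Set X} (hK : IsWeaklyCompact K)
    (g : ℕ → X →L[ℝ] ℝ) (C : X → ℝ) (hg : ∀ (J : Finset ℕ) y, ∑ n ∈ J, |g n y| ≤ C y)
    (x : ℕ → X) (hx : ∀ n, x n ∈ K) {ε : ℝ} (hε : 0 < ε) (hgx : ∀ n, ε ≤ g n (x n)) : False := by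
  rw [isWeaklyCompact_iff_ultrafilter] at hK
  have hsum : ∀ y, Summable fun n => |g n y| := fun y =>
    summable_of_sum_le (fun n => abs_nonneg _) (fun J => hg J y)
  have hle : ((hyperfilter ℕ : Ultrafilter ℕ) : Filter ℕ) ≤ atTop := by
    rw [← Nat.cofinite_eq_atTop]
    exact hyperfilter_le_cofinite
  obtain ⟨x₀, -, hx₀⟩ := hK ((hyperfilter ℕ).map x) (Ultrafilter.mem_map.2 (univ_mem' hx))
  set w : ℕ → X := fun n => x n - x₀ with hw
  have hw0 : ∀ m, Tendsto (fun n => g m (w n)) (hyperfilter ℕ) (𝓝 0) := fun m => by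
    have h1 : Tendsto (fun n => g m (x n) - g m x₀) (hyperfilter ℕ) (𝓝 (g m x₀ - g m x₀)) :=
      Tendsto.sub_const (hx₀ (g m)) _
    rw [sub_self] at h1
    exact h1.congr fun n => by simp [hw]
  have hlarge : ∀ᶠ n in hyperfilter ℕ, ε / 2 ≤ g n (w n) := by
    have h1 : Tendsto (fun n => |g n x₀|) atTop (𝓝 0) := (hsum x₀).tendsto_atTop_zero
    filter_upwards [hle (h1.eventually_lt_const (half_pos hε))] with n hn
    have := hgx n
    have := le_abs_self (g n x₀)
    simp only [hw, map_sub]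
    linarith
  -- The next index has a large diagonal value, earlier functionals are small at `w n'`, and
  -- functionals from `n'` on are small at `w n`. The bound `1 / (n + 1)` serves to identify the
  -- second limit below.
  have step : ∀ n, ∃ n', n < n' ∧ ε / 2 ≤ g n' (w n') ∧
      ∑ m ∈ Finset.range (n + 1), |g m (w n')| < ε / 8 ∧
      ∑ m ∈ Finset.range (n + 1), |g m (w n')| < 1 / ((n : ℝ) + 1) ∧
      ∀ J : Finset ℕ, (∀ m ∈ J, n' ≤ m) → ∑ m ∈ J, |g m (w n)| < ε / 8 := by
    intro n
    have h1 : Tendsto (fun n' => ∑ m ∈ Finset.range (n + 1), |g m (w n')|) (hyperfilter ℕ)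
        (𝓝 (∑ m ∈ Finset.range (n + 1), |(0 : ℝ)|)) :=
      tendsto_finsetSum _ fun m _ => (hw0 m).abs
    simp only [abs_zero, Finset.sum_const_zero] at h1
    obtain ⟨s, hs⟩ := summable_iff_vanishing_norm.1 (hsum (w n)) (ε / 8) (by positivity)
    obtain ⟨n', h2, h3, h4, h5, h6⟩ := (((eventually_gt_atTop n).filter_mono hle).and (hlarge.and
      ((h1.eventually_lt_const (by positivity : 0 < ε / 8)).and
      ((h1.eventually_lt_const (by positivity : 0 < 1 / ((n : ℝ) + 1))).and
      ((eventually_gt_atTop (s.sup id)).filter_mono hle))))).exists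
    refine ⟨n', h2, h3, h4, h5, fun J hJ => (le_abs_self _).trans_lt (hs J ?_)⟩
    rw [Finset.disjoint_left]
    intro m hmJ hms
    have := Finset.le_sup (f := id) hms
    have := hJ m hmJ
    simp only [id] at *
    omega
  choose nxt hlt hbig hhead hhead' htail using step
  set a : ℕ → ℕ := fun k => nxt^[k + 1] 0 with ha
  have hasucc : ∀ k, a (k + 1) = nxt (a k) := fun k => Function.iterate_succ_apply' nxt (k + 1) 0
  have hamono : StrictMono a := strictMono_nat_of_lt_succ fun k => by
    rw [hasucc]
    exact hlt _
  have hsum' : ∀ y, Summable fun k => g (a k) y := fun y =>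
    ((hsum y).comp_injective hamono.injective).of_abs
  choose φ hφ using hsum'
  set G : X →L[ℝ] ℝ := continuousLinearMapOfTendsto
    (fun L => ∑ j ∈ Finset.range L, g (a j)) (f := φ)
    (tendsto_pi_nhds.2 fun y => by simpa using (hφ y).tendsto_sum_nat) with hG
  have hGsum : ∀ y, HasSum (fun k => g (a k) y) (G y) := hφ
  have himage : ∀ (s : Finset ℕ) y, ∑ j ∈ s, |g (a j) y| = ∑ m ∈ s.image a, |g m y| := fun s y =>
    (Finset.sum_image (f := fun m => |g m y|) hamono.injective.injOn).symm
  -- The diagonal term is at least `ε / 2`, and head and tail each cost at most `ε / 8`.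
  have hGbig : ∀ k, ε / 4 ≤ G (w (a (k + 1))) := by
    intro k
    set y := w (a (k + 1)) with hy
    refine ge_of_tendsto (hGsum y).tendsto_sum_nat ?_
    filter_upwards [eventually_ge_atTop (k + 2)] with L hL
    rw [← Finset.sum_range_add_sum_Ico _ hL, Finset.sum_range_succ]
    have h1 : |∑ j ∈ Finset.range (k + 1), g (a j) y| < ε / 8 := by
      refine (Finset.abs_sum_le_sum_abs _ _).trans_lt ?_
      rw [himage]
      refine (Finset.sum_le_sum_of_subset_of_nonneg ?_ fun _ _ _ => abs_nonneg _).trans_lt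
        (hasucc k ▸ hhead (a k))
      intro m hm
      obtain ⟨j, hj, rfl⟩ := Finset.mem_image.1 hm
      rw [Finset.mem_range, Nat.lt_succ_iff] at hj ⊢
      exact hamono.monotone hj
    have h2 : |∑ j ∈ Finset.Ico (k + 2) L, g (a j) y| < ε / 8 := by
      refine (Finset.abs_sum_le_sum_abs _ _).trans_lt ?_
      rw [himage]
      refine htail (a (k + 1)) _ fun m hm => ?_
      obtain ⟨j, hj, rfl⟩ := Finset.mem_image.1 hm
      rw [← hasucc]
      exact hamono.monotone (Finset.mem_Ico.1 hj).1
    have h3 : ε / 2 ≤ g (a (k + 1)) y := by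
      rw [hy, hasucc]
      exact hbig _
    rw [abs_lt] at h1 h2
    linarith [h1.1, h2.1]
  -- The chosen indices need not belong to the first ultrafilter, so the subsequence gets its own
  -- limit `x₁`. Every `g m` kills `x₁ - x₀`, hence so does `G`, against `hGbig`.
  obtain ⟨x₁, -, hx₁⟩ := hK ((hyperfilter ℕ).map fun k => x (a (k + 1)))
    (Ultrafilter.mem_map.2 (univ_mem' fun k => hx _))
  have hlim : ∀ f : X →L[ℝ] ℝ,
      Tendsto (fun k => f (w (a (k + 1)))) (hyperfilter ℕ) (𝓝 (f (x₁ - x₀))) := fun f => by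
    have h1 : Tendsto (fun k => f (x (a (k + 1))) - f x₀) (hyperfilter ℕ) (𝓝 (f x₁ - f x₀)) :=
      Tendsto.sub_const (hx₁ f) _
    rw [map_sub]
    exact h1.congr fun n => by simp [hw]
  have hzero : ∀ m, g m (x₁ - x₀) = 0 := by
    intro m
    refine tendsto_nhds_unique (hlim (g m)) (Tendsto.mono_left ?_ hle)
    refine squeeze_zero_norm' ?_ tendsto_one_div_add_atTop_nhds_zero_nat
    filter_upwards [eventually_ge_atTop m] with k hk
    have hka : k ≤ a k := hamono.id_le k
    have h1 : |g m (w (a (k + 1)))| ≤ ∑ i ∈ Finset.range (a k + 1), |g i (w (a (k + 1)))| :=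
      Finset.single_le_sum (f := fun i => |g i (w (a (k + 1)))|) (fun _ _ => abs_nonneg _)
        (Finset.mem_range.2 (by omega))
    have h2 := hhead' (a k)
    rw [← hasucc] at h2
    have h3 : 1 / ((a k : ℝ) + 1) ≤ 1 / ((k : ℝ) + 1) := by
      have : (k : ℝ) ≤ a k := by exact_mod_cast hka
      gcongr
    rw [Real.norm_eq_abs]
    linarith
  have h1 : G (x₁ - x₀) = 0 := (hGsum _).unique (by simp [hzero])
  have h2 := ge_of_tendsto (hlim G) (Eventually.of_forall hGbig)
  linarith

end GlidingHump

/-! ### Disjoint families in the solid hull of a weakly compact set -/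

section Disjoint

/-- The right side expands to the meet of `a + b`, `c + b`, `a + c`, `c + c`, each above the left
side. -/
theorem add_inf_le_inf_add_inf {X : Type*} [AddCommGroup X] [Lattice X] [IsOrderedAddMonoid X]
    {a b c : X} (ha : 0 ≤ a) (hb : 0 ≤ b) (hc : 0 ≤ c) : (a + b) ⊓ c ≤ a ⊓ c + b ⊓ c := by
  rw [add_inf, inf_add, inf_add]
  refine le_inf (le_inf inf_le_left (inf_le_right.trans (le_add_of_nonneg_right hb)))
    (le_inf (inf_le_right.trans (le_add_of_nonneg_left ha))
      (inf_le_right.trans (le_add_of_nonneg_left hc)))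

theorem add_eq_sup_of_inf_eq_zero {X : Type*} [AddCommGroup X] [Lattice X] [IsOrderedAddMonoid X]
    {a b : X} (h : a ⊓ b = 0) : a + b = a ⊔ b := by
  rw [← inf_add_sup, h, zero_add]

/-- A sum of disjoint positive elements is their supremum. -/
theorem sum_le_of_pairwise_inf_eq_zero {X ι : Type*} [AddCommGroup X] [Lattice X]
    [IsOrderedAddMonoid X] {a : X} (ha : 0 ≤ a) {b : ι → X} (J : Finset ι)
    (hb0 : ∀ i ∈ J, 0 ≤ b i) (hba : ∀ i ∈ J, b i ≤ a)
    (hd : ∀ i ∈ J, ∀ j ∈ J, i ≠ j → b i ⊓ b j = 0) : ∑ i ∈ J, b i ≤ a := by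
  classical
  have hinf : ∀ (s : Finset ι) (c : X), 0 ≤ c → (∀ i ∈ s, 0 ≤ b i) → (∀ i ∈ s, b i ⊓ c = 0) →
      (∑ i ∈ s, b i) ⊓ c = 0 := by
    intro s c hc
    induction s using Finset.induction_on with
    | empty => intro _ _; simpa using hc
    | insert i s hi ih =>
      intro h0 h1
      rw [Finset.forall_mem_insert] at h0 h1
      rw [Finset.sum_insert hi]
      have h2 := add_inf_le_inf_add_inf h0.1 (Finset.sum_nonneg h0.2) hc
      rw [h1.1, ih h0.2 h1.2, add_zero] at h2
      exact le_antisymm h2 (le_inf (add_nonneg h0.1 (Finset.sum_nonneg h0.2)) hc)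
  induction J using Finset.induction_on with
  | empty => simpa using ha
  | insert i s hi ih =>
    rw [Finset.sum_insert hi, add_comm, add_eq_sup_of_inf_eq_zero]
    · refine sup_le (ih (fun j hj => hb0 j (Finset.mem_insert_of_mem hj))
        (fun j hj => hba j (Finset.mem_insert_of_mem hj))
        (fun j hj k hk => hd j (Finset.mem_insert_of_mem hj) k (Finset.mem_insert_of_mem hk)))
        (hba i (Finset.mem_insert_self i s))
    · refine hinf s (b i) (hb0 i (Finset.mem_insert_self i s))
        (fun j hj => hb0 j (Finset.mem_insert_of_mem hj)) fun j hj =>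
        hd j (Finset.mem_insert_of_mem hj) i (Finset.mem_insert_self i s) ?_
      rintro rfl
      exact hi hj

theorem natCast_smul_inf_eq_zero {X : Type*} [AddCommGroup X] [Lattice X] [Module ℝ X]
    [IsOrderedModule ℝ X] {a b : X} (h : a ⊓ b = 0) (k : ℕ) :
    (k : ℝ) • a ⊓ (k : ℝ) • b = 0 := by
  rcases k.eq_zero_or_pos with rfl | hk
  · simp
  · rw [← smul_inf_of_pos (by exact_mod_cast hk), h, smul_zero]

variable {X : Type*} [NormedAddCommGroup X] [Lattice X] [IsOrderedAddMonoid X]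
    [HasSolidNorm X] [NormedSpace ℝ X] [IsOrderedModule ℝ X]

/-- The restriction of a positive functional `h` to the band generated by `e`, controlled by the
functional `y ↦ sup_k h (|y| ⊓ k e)`. -/
theorem exists_dual_le_band {h : X →L[ℝ] ℝ} (hh : IsPositiveFunctional h) {e : X} (he : 0 ≤ e)
    {x : X} (hex : e ≤ |x|) :
    ∃ g : X →L[ℝ] ℝ, h e ≤ g x ∧
      ∀ y r, (∀ k : ℕ, h (|y| ⊓ (k : ℝ) • e) ≤ r) → |g y| ≤ r := by
  have hke : ∀ k : ℕ, 0 ≤ (k : ℝ) • e := fun k => smul_nonneg k.cast_nonneg he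
  obtain ⟨g, hg, hgx⟩ := exists_dual_le_of_cone
    (fun (y : X) r => ∀ k : ℕ, h (|y| ⊓ (k : ℝ) • e) ≤ r) ‖h‖
    (by
      intro c hc y r hr k
      -- With `n > k / c`, the truncation at `k e` of `|c y|` lies below `c` times the truncation at
      -- `n e` of `|y|`.
      obtain ⟨n, hn⟩ := exists_nat_gt (k / c)
      rw [div_lt_iff₀' hc] at hn
      have h1 : |c • y| ⊓ (k : ℝ) • e ≤ c • (|y| ⊓ (n : ℝ) • e) := by
        rw [smul_inf_of_pos hc, abs_smul_of_pos hc, smul_smul]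
        exact inf_le_inf_left _ (smul_le_smul_of_nonneg_right hn.le he)
      have h2 := hh.mono h1
      rw [map_smul, smul_eq_mul] at h2
      exact h2.trans (mul_le_mul_of_nonneg_left (hr n) hc.le))
    (by
      intro y z r s hr hs k
      have h1 := hh.mono ((inf_le_inf_right _ (abs_add_le y z)).trans
        (add_inf_le_inf_add_inf (abs_nonneg y) (abs_nonneg z) (hke k)))
      rw [map_add] at h1
      linarith [hr k, hs k])
    (fun y r hr => by
      have := hh _ (le_inf (abs_nonneg y) (hke 0))
      linarith [hr 0, mul_nonneg (norm_nonneg h) (norm_nonneg y)])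
    (fun y => ⟨h |y|, fun k => hh.mono inf_le_left, by
      rw [← norm_abs_eq_norm y]
      exact (le_abs_self _).trans (h.le_opNorm _)⟩) x
  refine ⟨g, ?_, fun y r hr => abs_le.2 ⟨?_, hg y r hr⟩⟩
  · rw [hgx]
    refine le_csInf ⟨h |x|, fun k => hh.mono inf_le_left⟩ fun r hr => ?_
    have := hr 1
    rwa [Nat.cast_one, one_smul, inf_eq_right.2 hex] at this
  · have := hg (-y) r (by rwa [abs_neg])
    rw [map_neg] at this
    linarith

variable [CompleteSpace X]

/-- A disjoint family in the solid hull of a weakly compact set is weakly null. -/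
theorem IsWeaklyCompact.finite_setOf_le_of_disjoint {K : Set X} (hK : IsWeaklyCompact K)
    {E : Set X} (hE0 : ∀ e ∈ E, 0 ≤ e) (hEK : ∀ e ∈ E, ∃ x ∈ K, e ≤ |x|)
    (hEd : ∀ a ∈ E, ∀ b ∈ E, a ≠ b → a ⊓ b = 0) {h : X →L[ℝ] ℝ} (hh : IsPositiveFunctional h)
    {ε : ℝ} (hε : 0 < ε) : {e ∈ E | ε ≤ h e}.Finite := by
  by_contra hinf
  set e := Set.Infinite.natEmbedding _ hinf with he
  have heE : ∀ n, (e n : X) ∈ E := fun n => (e n).2.1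
  choose x hxK hex using fun n => hEK _ (heE n)
  choose g hgx hg using fun n => exists_dual_le_band hh (hE0 _ (heE n)) (hex n)
  refine hK.false_of_forall_le g (fun y => h |y|) (fun J y => ?_) x hxK hε
    fun n => (e n).2.2.trans (hgx n)
  have hmono : ∀ n, Monotone fun k : ℕ => h (|y| ⊓ (k : ℝ) • (e n : X)) := fun n k l hkl =>
    hh.mono (inf_le_inf_left _ (smul_le_smul_of_nonneg_right (by exact_mod_cast hkl)
      (hE0 _ (heE n))))
  have hbdd : ∀ n, BddAbove (Set.range fun k : ℕ => h (|y| ⊓ (k : ℝ) • (e n : X))) := fun n =>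
    ⟨h |y|, by rintro _ ⟨k, rfl⟩; exact hh.mono inf_le_left⟩
  -- For a common `k`, the truncations `|y| ⊓ k e_n` are disjoint and below `|y|`, so their sum is
  -- too. Letting `k → ∞` over the finite set `J` bounds the sum of suprema by `h |y|`.
  refine (Finset.sum_le_sum fun n _ => hg n y _ (le_ciSup (hbdd n))).trans ?_
  refine le_of_tendsto (tendsto_finsetSum J fun n _ => tendsto_atTop_ciSup (hmono n) (hbdd n))
    (Eventually.of_forall fun k => ?_)
  have hk0 : ∀ n, 0 ≤ (k : ℝ) • (e n : X) := fun n => smul_nonneg k.cast_nonneg (hE0 _ (heE n))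
  rw [← map_sum]
  refine hh.mono (sum_le_of_pairwise_inf_eq_zero (abs_nonneg y) J
    (fun n _ => le_inf (abs_nonneg y) (hk0 n)) (fun n _ => inf_le_left) fun m _ n _ hmn => ?_)
  refine le_antisymm ?_ (le_inf (le_inf (abs_nonneg y) (hk0 m)) (le_inf (abs_nonneg y) (hk0 n)))
  rw [← natCast_smul_inf_eq_zero (hEd _ (heE m) _ (heE n)
    fun h => hmn (e.injective (Subtype.ext h))) k]
  exact inf_le_inf inf_le_right inf_le_right

end Disjoint

/-! ### Disjoint complements, maximal disjoint families and the generating set -/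

section Bands

variable {X : Type*} [NormedAddCommGroup X] [Lattice X] [IsOrderedAddMonoid X]
    [NormedSpace ℝ X] [IsOrderedModule ℝ X]

theorem abs_inf_eq_zero_of_le {X : Type*} [AddCommGroup X] [Lattice X] [IsOrderedAddMonoid X]
    {x y z : X} (hz : 0 ≤ z) (hxy : |x| ≤ y) (h : y ⊓ z = 0) :
    |x| ⊓ z = 0 :=
  le_antisymm ((inf_le_inf_right z hxy).trans_eq h) (le_inf (abs_nonneg x) hz)

/-- The elements disjoint from a positive element `y`. -/
def disjointComplement (y : X) (hy : 0 ≤ y) : Submodule ℝ X where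
  carrier := {z | |z| ⊓ y = 0}
  zero_mem' := by simpa using hy
  add_mem' := by
    intro a b (ha : |a| ⊓ y = 0) (hb : |b| ⊓ y = 0)
    refine abs_inf_eq_zero_of_le hy (abs_add_le a b) (le_antisymm ?_
      (le_inf (add_nonneg (abs_nonneg a) (abs_nonneg b)) hy))
    have := add_inf_le_inf_add_inf (abs_nonneg a) (abs_nonneg b) hy
    rwa [ha, hb, add_zero] at this
  smul_mem' := by
    intro c z (hz : |z| ⊓ y = 0)
    -- `n` dominates both `|c|` and `1`, so `|c • z| ≤ n |z|` and `y ≤ n y`, and both sides scale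
    -- together.
    obtain ⟨n, hn⟩ := exists_nat_gt (max |c| 1)
    rw [max_lt_iff] at hn
    have hcz : |c • z| ≤ (n : ℝ) • |z| := by
      refine sup_le ?_ ?_
      · calc c • z ≤ |c| • |z| := by
              rcases le_total 0 c with hc | hc
              · rw [abs_of_nonneg hc]
                exact smul_le_smul_of_nonneg_left (le_abs_self z) hc
              · rw [abs_of_nonpos hc, ← neg_smul_neg]
                exact smul_le_smul_of_nonneg_left (neg_le_abs z) (neg_nonneg.2 hc)
          _ ≤ _ := smul_le_smul_of_nonneg_right hn.1.le (abs_nonneg z)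
      · calc -(c • z) ≤ |c| • |z| := by
              rcases le_total 0 c with hc | hc
              · rw [abs_of_nonneg hc, ← smul_neg]
                exact smul_le_smul_of_nonneg_left (neg_le_abs z) hc
              · rw [abs_of_nonpos hc, ← neg_smul]
                exact smul_le_smul_of_nonneg_left (le_abs_self z) (neg_nonneg.2 hc)
          _ ≤ _ := smul_le_smul_of_nonneg_right hn.1.le (abs_nonneg z)
    refine abs_inf_eq_zero_of_le hy hcz (le_antisymm ?_
      (le_inf (smul_nonneg n.cast_nonneg (abs_nonneg z)) hy))
    rw [← natCast_smul_inf_eq_zero hz n]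
    refine inf_le_inf_left _ ?_
    simpa using smul_le_smul_of_nonneg_right hn.2.le hy

theorem mem_disjointComplement {y : X} {hy : 0 ≤ y} {z : X} :
    z ∈ disjointComplement y hy ↔ |z| ⊓ y = 0 :=
  Iff.rfl

variable [HasSolidNorm X]

/-- For suprema: `w = s⁺ ⊓ y` is disjoint from every `a⁺`, so `a⁺ + w = a⁺ ⊔ w ≤ s⁺`. Thus `s⁺ - w`
is an upper bound of `A`, which forces `w = 0`. -/
theorem isClosedBand_disjointComplement (y : X) (hy : 0 ≤ y) :
    IsClosedBand (disjointComplement y hy) where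
  isClosed := by
    have : Continuous fun z : X => |z| ⊓ y := by
      unfold abs
      fun_prop
    exact isClosed_singleton.preimage this
  solid := fun x z hxz hz => abs_inf_eq_zero_of_le hy hxz hz
  isLUB_mem := by
    intro A s hA hs
    set w := s⁺ ⊓ y with hw
    have hw0 : 0 ≤ w := le_inf (posPart_nonneg s) hy
    have hle : s ≤ s⁺ - w := hs.2 fun a ha => by
      have h1 : a⁺ ⊓ w = 0 := le_antisymm
        (((inf_le_inf (sup_le (le_abs_self a) (abs_nonneg a)) inf_le_right)).trans_eq (hA ha))
        (le_inf (posPart_nonneg a) hw0)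
      have h2 : a⁺ + w ≤ s⁺ := by
        rw [add_eq_sup_of_inf_eq_zero h1]
        exact sup_le (sup_le_sup_right (hs.1 ha) 0) inf_le_left
      exact (le_posPart a).trans (le_sub_iff_add_le.2 h2)
    have hpos : s⁺ ⊓ y = 0 := by
      have h1 : s⁺ ≤ s⁺ - w := sup_le hle (sub_nonneg.2 inf_le_left)
      exact le_antisymm (by simpa using h1) hw0
    have hneg : s⁻ ⊓ y = 0 := by
      -- A supremum of the empty set is a least element of `X`, which forces `s⁻ = 0`; otherwise `s⁻
      -- ≤ |a|`.
      rcases A.eq_empty_or_nonempty with rfl | ⟨a, ha⟩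
      · have h1 : s ≤ s - s⁻ := hs.2 (by simp)
        have h2 : s⁻ = 0 := le_antisymm (by simpa using h1) (negPart_nonneg s)
        rw [h2, inf_eq_left.2 hy]
      · refine le_antisymm ((inf_le_inf_right y ?_).trans_eq (hA ha))
          (le_inf (negPart_nonneg s) hy)
        exact sup_le ((neg_le_neg (hs.1 ha)).trans (neg_le_abs a)) (abs_nonneg a)
    have h1 := add_inf_le_inf_add_inf (posPart_nonneg s) (negPart_nonneg s) hy
    rw [hpos, hneg, add_zero, posPart_add_negPart] at h1
    exact le_antisymm h1 (le_inf (abs_nonneg s) hy)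

/-- If `K` generates `X` as a band, then a nonzero positive element meets some element of `K`. -/
theorem exists_abs_inf_ne_zero {K : Set X} (hK : bandGeneratedBy K = ⊤) {y : X} (hy : 0 ≤ y)
    (hy0 : y ≠ 0) : ∃ x ∈ K, |x| ⊓ y ≠ 0 := by
  by_contra! hcon
  have hmem : y ∈ bandGeneratedBy K := hK ▸ Submodule.mem_top
  have h1 := Submodule.mem_sInf.1 hmem (disjointComplement y hy)
    ⟨isClosedBand_disjointComplement y hy, hcon⟩
  rw [mem_disjointComplement, abs_of_nonneg hy, inf_idem] at h1
  exact hy0 h1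

/-- If `K` generates `X` as a band, then the solid hull of `K` contains a disjoint family of
positive elements that is maximal in `X`. -/
theorem exists_maximal_disjoint {K : Set X} (hK : bandGeneratedBy K = ⊤) :
    ∃ E : Set X, (∀ e ∈ E, 0 ≤ e) ∧ (∀ e ∈ E, ∃ x ∈ K, e ≤ |x|) ∧
      (∀ a ∈ E, ∀ b ∈ E, a ≠ b → a ⊓ b = 0) ∧
      ∀ y, 0 ≤ y → (∀ e ∈ E, y ⊓ e = 0) → y = 0 := by
  obtain ⟨E, hE⟩ := zorn_subset {E : Set X | (∀ e ∈ E, 0 ≤ e ∧ ∃ x ∈ K, e ≤ |x|) ∧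
      ∀ a ∈ E, ∀ b ∈ E, a ≠ b → a ⊓ b = 0} (by
    intro c hc hchain
    refine ⟨⋃₀ c, ⟨?_, ?_⟩, fun s hs => Set.subset_sUnion_of_mem hs⟩
    · rintro e ⟨s, hs, hes⟩
      exact (hc hs).1 e hes
    · rintro a ⟨s, hs, has⟩ b ⟨t, ht, hbt⟩ hab
      rcases hchain.total hs ht with hst | hts
      · exact (hc ht).2 a (hst has) b hbt hab
      · exact (hc hs).2 a has b (hts hbt) hab)
  obtain ⟨hEK, hEd⟩ := hE.prop
  refine ⟨E, fun e he => (hEK e he).1, fun e he => (hEK e he).2, hEd, fun y hy hyE => ?_⟩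
  by_contra hne
  obtain ⟨x, hxK, hx⟩ := exists_abs_inf_ne_zero hK hy hne
  have hd0 : 0 ≤ |x| ⊓ y := le_inf (abs_nonneg x) hy
  have hdE : ∀ e ∈ E, (|x| ⊓ y) ⊓ e = 0 := fun e he =>
    le_antisymm ((inf_le_inf_right e inf_le_right).trans_eq (hyE e he)) (le_inf hd0 (hEK e he).1)
  -- Maximality puts `|x| ⊓ y` in `E`, where it is disjoint from itself.
  have hmem : |x| ⊓ y ∈ E := hE.le_of_ge (y := insert (|x| ⊓ y) E) ⟨by
      rintro e (rfl | he)
      · exact ⟨hd0, x, hxK, inf_le_left⟩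
      · exact hEK e he, by
      rintro a (rfl | ha) b (rfl | hb) hab
      · exact absurd rfl hab
      · exact hdE b hb
      · rw [inf_comm]
        exact hdE a ha
      · exact hEd a ha b hb hab⟩ (Set.subset_insert _ _) (Set.mem_insert _ _)
  exact hx (by simpa using hdE _ hmem)

variable [CompleteSpace X]

/-- The union of the intervals `[0, e]` over a weakly null disjoint family is weakly compact. -/
theorem IsOrderContinuous.isWeaklyCompact_biUnion_Icc (hX : IsOrderContinuous X) {E : Set X}
    (hE0 : ∀ e ∈ E, 0 ≤ e)
    (hE : ∀ h : X →L[ℝ] ℝ, IsPositiveFunctional h → ∀ ε : ℝ, 0 < ε → {e ∈ E | ε ≤ h e}.Finite) :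
    IsWeaklyCompact (insert 0 (⋃ e ∈ E, Set.Icc 0 e)) := by
  rw [isWeaklyCompact_iff_ultrafilter]
  intro U hU
  by_cases hcase : ∃ e ∈ E, Set.Icc 0 e ∈ U
  · obtain ⟨e, he, heU⟩ := hcase
    obtain ⟨x, hx, hUx⟩ :=
      isWeaklyCompact_iff_ultrafilter.1 (hX.isWeaklyCompact_Icc (hE0 e he)) U heU
    exact ⟨x, Or.inr (Set.mem_biUnion he hx), hUx⟩
  · refine ⟨0, Or.inl rfl, fun f => ?_⟩
    obtain ⟨g, hg, hgf⟩ := exists_positiveFunctional_sub_eq f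
    have hpos := hg.add hgf
    rw [map_zero, Metric.tendsto_nhds]
    intro ε hε
    by_contra hcon
    refine hcase ?_
    have hU' : {z | ¬ dist (f z) 0 < ε} ∈ U := Ultrafilter.compl_mem_iff_notMem.2 hcon
    have hfin := hE _ hpos ε hε
    -- On positive elements `|f| ≤ g + (g - f)`, so if `f` does not tend to `0`, `U` lives on
    -- finitely many intervals and contains one of them.
    have h1 : (⋃ e ∈ {e ∈ E | ε ≤ (g + (g - f)) e}, Set.Icc 0 e) ∈ U := by
      filter_upwards [hU, hU'] with z hz hzf
      rw [dist_zero_right, Real.norm_eq_abs, not_lt] at hzf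
      rcases hz with rfl | hz
      · rw [map_zero, abs_zero] at hzf
        exact absurd hε hzf.not_gt
      · obtain ⟨e, he, hze⟩ := Set.mem_iUnion₂.1 hz
        refine Set.mem_biUnion ⟨he, hzf.trans (le_trans ?_ (hpos.mono hze.2))⟩ hze
        have h2 := hg z hze.1
        have h3 := hgf z hze.1
        simp only [add_apply, sub_apply] at h3 ⊢
        exact abs_le.2 ⟨by linarith, by linarith⟩
    obtain ⟨e, he, heU⟩ := (Ultrafilter.finite_biUnion_mem_iff hfin).1 h1
    exact ⟨e, he.1, heU⟩

/-- In an order continuous Banach lattice, the intervals `[0, e]` over a maximal disjoint family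
span a dense subspace. -/
theorem IsOrderContinuous.topologicalClosure_span_eq_top (hX : IsOrderContinuous X) {E : Set X}
    (hE0 : ∀ e ∈ E, 0 ≤ e) (hEd : ∀ a ∈ E, ∀ b ∈ E, a ≠ b → a ⊓ b = 0)
    (hmax : ∀ y, 0 ≤ y → (∀ e ∈ E, y ⊓ e = 0) → y = 0) :
    (Submodule.span ℝ (insert 0 (⋃ e ∈ E, Set.Icc 0 e))).topologicalClosure = ⊤ := by
  classical
  set Y := Submodule.span ℝ (insert 0 (⋃ e ∈ E, Set.Icc 0 e)) with hY
  have hIcc : ∀ e ∈ E, ∀ z, 0 ≤ z → z ≤ e → z ∈ Y := fun e he z hz hze =>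
    Submodule.subset_span (Or.inr (Set.mem_biUnion he ⟨hz, hze⟩))
  suffices hpos : ∀ x, 0 ≤ x → x ∈ Y.topologicalClosure by
    rw [Submodule.eq_top_iff']
    intro x
    rw [← posPart_sub_negPart x]
    exact sub_mem (hpos _ (posPart_nonneg x)) (hpos _ (negPart_nonneg x))
  intro x hx
  have hne0 : ∀ (e : E) (n : ℕ), 0 ≤ (n : ℝ) • (e : X) := fun e n =>
    smul_nonneg n.cast_nonneg (hE0 e e.2)
  have hterm : ∀ (e : E) (n : ℕ), 0 ≤ x ⊓ (n : ℝ) • (e : X) := fun e n => le_inf hx (hne0 e n)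
  let f : Finset E × ℕ → X := fun p => ∑ e ∈ p.1, x ⊓ (p.2 : ℝ) • (e : X)
  have hfx : ∀ p, f p ≤ x := fun p =>
    sum_le_of_pairwise_inf_eq_zero hx p.1 (fun e _ => hterm e p.2) (fun e _ => inf_le_left)
      fun a _ b _ hab => le_antisymm ((inf_le_inf inf_le_right inf_le_right).trans_eq
        (natCast_smul_inf_eq_zero (hEd a a.2 b b.2 fun h => hab (Subtype.ext h)) p.2))
        (le_inf (hterm a p.2) (hterm b p.2))
  have hmono : Monotone f := by
    rintro ⟨J, n⟩ ⟨J', n'⟩ ⟨hJ : J ≤ J', hn : n ≤ n'⟩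
    refine (Finset.sum_le_sum fun (e : E) _ => inf_le_inf_left x
      (smul_le_smul_of_nonneg_right (Nat.cast_le.2 hn) (hE0 e e.2))).trans ?_
    exact Finset.sum_le_sum_of_subset_of_nonneg hJ fun e _ _ => hterm e n'
  have hfY : ∀ p, f p ∈ Y := by
    rintro ⟨J, n⟩
    refine sum_mem fun e _ => ?_
    rcases n.eq_zero_or_pos with rfl | hn
    · simp [inf_eq_right.2 hx]
    · have hn' : (0 : ℝ) < n := by exact_mod_cast hn
      -- Rescaling by `n` brings the truncation into `[0, e]`.
      have h1 : x ⊓ (n : ℝ) • (e : X) = (n : ℝ) • (((n : ℝ)⁻¹ • x) ⊓ e) := by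
        rw [smul_inf_of_pos hn', smul_inv_smul₀ hn'.ne']
      rw [h1]
      exact Y.smul_mem _ (hIcc e e.2 _
        (le_inf (smul_nonneg (inv_nonneg.2 hn'.le) hx) (hE0 e e.2)) inf_le_right)
  obtain ⟨s, hs⟩ := hX.exists_tendsto_of_monotone hmono ⟨x, by rintro _ ⟨p, rfl⟩; exact hfx p⟩
  have hlub := isLUB_of_tendsto_atTop hmono hs
  have hfs : ∀ p, f p ≤ s := fun p => hlub.1 ⟨p, rfl⟩
  have hsx : s ≤ x := le_of_tendsto hs (Eventually.of_forall hfx)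
  have hsY : s ∈ Y.topologicalClosure := mem_closure_of_tendsto hs (Eventually.of_forall hfY)
  have hdisj : x - s = 0 := by
    refine hmax _ (sub_nonneg.2 hsx) fun e he => ?_
    set w := (x - s) ⊓ e with hw
    have hw0 : 0 ≤ w := le_inf (sub_nonneg.2 hsx) (hE0 e he)
    -- Adding `e` to `J` and raising `n` to `n + 1` increases the sum by at least `w`, so `s - w`
    -- still bounds all sums.
    have hle : s ≤ s - w := hlub.2 (by
      rintro _ ⟨⟨J, n⟩, rfl⟩
      rw [le_sub_iff_add_le]
      refine le_trans ?_ (hfs (insert ⟨e, he⟩ J, n + 1))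
      have h1 : f (J, n) ≤ f (insert ⟨e, he⟩ J, n) :=
        hmono ⟨Finset.subset_insert _ _, le_rfl⟩
      refine (add_le_add_left h1 w).trans ?_
      have h2 : x ⊓ (n : ℝ) • e + w ≤ x ⊓ ((n + 1 : ℕ) : ℝ) • e := by
        refine le_inf ?_ ?_
        · have h3 : x ⊓ (n : ℝ) • e ≤ s := by simpa [f] using hfs ({⟨e, he⟩}, n)
          calc x ⊓ (n : ℝ) • e + w ≤ s + (x - s) := add_le_add h3 inf_le_left
            _ = x := add_sub_cancel _ _
        · rw [Nat.cast_add, Nat.cast_one, add_smul, one_smul]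
          exact add_le_add inf_le_right inf_le_right
      have h4 : ⟨e, he⟩ ∈ insert (⟨e, he⟩ : E) J := Finset.mem_insert_self _ _
      simp only [f]
      rw [← Finset.add_sum_erase _ _ h4, ← Finset.add_sum_erase _ _ h4, add_right_comm]
      exact add_le_add h2 (Finset.sum_le_sum fun (a : E) _ => inf_le_inf_left x
        (smul_le_smul_of_nonneg_right (Nat.cast_le.2 n.le_succ) (hE0 a a.2))))
    exact le_antisymm (by simpa using hle) hw0
  rw [sub_eq_zero.1 hdisj]
  exact hsY

end Bands

/-! ### The equivalence -/

theorem theorem3p1 (X : Type*) [NormedAddCommGroup X] [Lattice X] [IsOrderedAddMonoid X]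
    [HasSolidNorm X] [NormedSpace ℝ X] [IsOrderedModule ℝ X] [CompleteSpace X]
    (hX : IsOrderContinuous X) :
    IsBWCG X ↔ IsWCG X := by
  constructor
  · rintro ⟨K, hK, hKtop⟩
    obtain ⟨E, hE0, hEK, hEd, hmax⟩ := exists_maximal_disjoint hKtop
    exact ⟨_, hX.isWeaklyCompact_biUnion_Icc hE0
      fun h hh ε hε => hK.finite_setOf_le_of_disjoint hE0 hEK hEd hh hε,
      hX.topologicalClosure_span_eq_top hE0 hEd hmax⟩
  · rintro ⟨K, hK, hKtop⟩
    refine ⟨K, hK, top_le_iff.1 ?_⟩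
    rw [← hKtop]
    exact Submodule.topologicalClosure_minimal _
      (Submodule.span_le.2 (subset_bandGeneratedBy K)) (isClosedBand_bandGeneratedBy K).isClosed
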